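/- Let $k$ be a perfect field, let $S = k[x_1,\dots,x_d]$, and let $J \subset S$ be an ideal with $\dim S/J > 0$ that is generated by forms $(f_i)_{i}$ of the same degree. Let $\mathrm{bigheight}(J)$ denote the maximum of the heights of the minimal primes of $J$, and for an ideal $I\subset S$ and $n \ge 0$ let $$I^{(n)} = \bigcap_{P} \left(I^n S_P \cap S\right),$$ where $P$ ranges over the minimal primes of $I$ and $I^nS_P\cap S$ is the preimage of $I^nS_P$ in $S$, denote the $n$-th symbolic power. Then every $d\times d$ minor of the Jacobian matrix $(\partial f_i/\partial x_j)_{i,j}$ lies in $(\sqrt J)^{(d-\mathrm{bigheight}(J)+1)}$. -/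

import Mathlib

/-- The big height of an ideal: the supremum of the heights of its minimal primes. -/
noncomputable def bigHeight {R : Type*} [CommRing R] (I : Ideal R) : ℕ∞ :=
  ⨆ p ∈ I.minimalPrimes, p.height

/-- The `n`-th symbolic power of an ideal `I`: the intersection, over the minimal primes `p` of `I`,
of the contractions to `R` of the extensions of `I ^ n` to the localizations `R_p`.
(For a radical ideal of a Noetherian ring, the minimal primes are exactly the associated primes.) -/
noncomputable def symbolicPower {R : Type*} [CommRing R] (I : Ideal R) (n : ℕ) : Ideal R :=
  ⨅ (p : PrimeSpectrum R) (_ : p.asIdeal ∈ I.minimalPrimes),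
    ((I ^ n).map (algebraMap R (Localization.AtPrime p.asIdeal))).comap
      (algebraMap R (Localization.AtPrime p.asIdeal))

/-- The Jacobian matrix `(∂ f_i / ∂ x_j)` of a family of polynomials. -/
noncomputable def jacobianMatrix {k σ ι : Type*} [CommRing k] (f : ι → MvPolynomial σ k) :
    Matrix ι σ (MvPolynomial σ k) :=
  Matrix.of fun i j => MvPolynomial.pderiv j (f i)

open MvPolynomial

attribute [local instance] MvPolynomial.gradedAlgebra

/-! Let `P` be a minimal prime of `J`, of height `h`. Locally at `P`, `√J` equals `P` and is
generated by `h` elements `g_l`, so `s f_i = ∑ a_il g_l` with `s ∉ P`. Differentiating shows that,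
modulo `P`, `s` times the Jacobian matrix factors through rank `h`; this alone puts the minor in `P
^ (d - h)` locally.

The extra power comes from Euler's formula: replacing column `j` by `∑ x_l · (column l)` multiplies
the minor by `x_j` and turns that column into `δ s f_i`, which lies in `P`. Since `dim S/J > 0`,
some `x_j` is outside `P`, hence invertible locally. There is no division by `δ`, so the
characteristic plays no role. -/

/-- If the `j`-th column of `C` vanishes, the `j`-th column of `B` and all entries of `C` lie in `I`,
and `A` has `card κ` columns, then `det (A * B + C)` lies in the `(card n - card κ + 1)`-st power
of `I`. -/
theorem Matrix.det_add_mem_pow_of_col_mem {R n κ : Type*} [CommRing R] [IsDomain R] [Fintype n]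
    [DecidableEq n] [Fintype κ] (I : Ideal R) (A : Matrix n κ R) (B : Matrix κ n R)
    (C : Matrix n n R) (j : n) (hB : ∀ l, B l j ∈ I) (hC : ∀ a b, C a b ∈ I)
    (hCj : ∀ a, C a j = 0) :
    (A * B + C).det ∈ I ^ (Fintype.card n - Fintype.card κ + 1) := by
  classical
  let u : n → n → R := fun b a => ∑ l, A a l * B l b
  let v : n → n → R := fun b a => C a b
  -- Multilinearity in the columns: `s` is the set of columns taken from `A * B`, the others come
  -- from `C`.
  have hexp : (A * B + C).det = ∑ s : Finset n, (Matrix.of (s.piecewise u v)).det := by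
    rw [← Matrix.det_transpose]
    exact (Matrix.detRowAlternating (R := R) (n := n)).toMultilinearMap.map_add_univ u v
  rw [hexp]
  refine Ideal.sum_mem _ fun s _ => ?_
  by_cases hj : j ∈ s
  · by_cases hs : s.card ≤ Fintype.card κ
    · rw [Matrix.det_apply]
      refine Ideal.sum_mem _ fun σ _ => Submodule.smul_of_tower_mem _ _ ?_
      -- Index the factors by columns: those outside `s` lie in `I` through `C`, and column `j`
      -- gives one more through `B`.
      rw [← Equiv.prod_comp σ⁻¹]
      have hmem : ∏ b, s.piecewise u v b (σ⁻¹ b) ∈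
          ∏ b : n, if b = j ∨ b ∉ s then I else ⊤ := by
        refine Ideal.prod_mem_prod fun b _ => ?_
        split_ifs with hb
        · rcases hb with rfl | hb
          · rw [Finset.piecewise_eq_of_mem _ _ _ hj]
            exact Ideal.sum_mem _ fun l _ => I.mul_mem_left _ (hB l)
          · rw [Finset.piecewise_eq_of_notMem _ _ _ hb]
            exact hC _ _
        · trivial
      have hcard : Fintype.card n - Fintype.card κ + 1 ≤
          (Finset.univ.filter fun b => b = j ∨ b ∉ s).card := by
        have : (Finset.univ.filter fun b => b = j ∨ b ∉ s) = insert j sᶜ := by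
          ext b; simp
        rw [this, Finset.card_insert_of_notMem (by simpa using hj), Finset.card_compl]
        omega
      rw [Finset.prod_ite, Finset.prod_const, ← Ideal.one_eq_top, Finset.prod_const_one,
        mul_one] at hmem
      refine Ideal.pow_le_pow_right hcard ?_
      convert hmem using 2
      simp
    -- More than `card κ` of the vectors lie in the span of the `card κ` columns of `A`.
    · have hdep : ¬ LinearIndependent R (s.piecewise u v) := fun hli => by
        refine hs ?_
        have : Fintype (Set.range fun l a => A a l) := Fintype.ofFinite _
        have h := linearIndependent_le_span_aux' _
          (hli.comp ((↑) : s → n) Subtype.val_injective) (Set.range fun l a => A a l) ?_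
        · rw [Fintype.card_coe] at h
          exact h.trans (Fintype.card_le_of_surjective _ Set.rangeFactorization_surjective)
        · rintro _ ⟨b, rfl⟩
          simp only [Function.comp_apply, Finset.piecewise_eq_of_mem _ _ _ b.2]
          have : u b = ∑ l, B l b • fun a => A a l := by
            ext a; simp [u, mul_comm]
          rw [this]
          exact Submodule.sum_mem _ fun l _ =>
            Submodule.smul_mem _ _ (Submodule.subset_span ⟨l, rfl⟩)
      have h0 : (Matrix.of (s.piecewise u v)).det = 0 :=
        Matrix.detRowAlternating.map_linearDependent _ hdep
      rw [h0]
      exact zero_mem _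
  · rw [Matrix.det_eq_zero_of_row_eq_zero j]
    · exact zero_mem _
    · intro a
      rw [Matrix.of_apply, Finset.piecewise_eq_of_notMem _ _ _ hj]
      exact hCj a

/-- A prime ideal `P` of a regular ring is, locally at `P`, generated by `P.height` elements. -/
theorem Ideal.exists_generators_atPrime_of_isRegularRing {R : Type*} [CommRing R] [IsRegularRing R]
    (P : Ideal R) [P.IsPrime] :
    ∃ g : Fin P.height.toNat → R, (∀ l, g l ∈ P) ∧
      ∀ x ∈ P, ∃ s ∉ P, s * x ∈ Ideal.span (Set.range g) := by
  let A := Localization.AtPrime P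
  let m := IsLocalRing.maximalIdeal A
  have hfg : Submodule.FG m := m.fg_of_isNoetherianRing
  -- Regularity: the minimal number of generators of `m` is the dimension of the local ring, which
  -- is the height of `P`.
  have hcard : (Submodule.generators m).ncard = P.height.toNat := by
    rw [hfg.generators_ncard]
    have h := (isRegularLocalRing_iff A).mp inferInstance
    rw [IsLocalization.AtPrime.ringKrullDim_eq_height P] at h
    have h' : ((m.spanFinrank : ℕ∞) : WithBot ℕ∞) = P.height := h
    rw [← WithBot.coe_inj.mp h', ENat.toNat_natCast]
  have hfin := hfg.finite_generators
  let e : Fin P.height.toNat ≃ (Submodule.generators m) :=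
    (finCongr hcard.symm).trans (hfin.equivFin.trans (finCongr rfl)).symm
  have hmem : ∀ l, ∃ x : P × P.primeCompl,
      (e l : A) * algebraMap R A x.2 = algebraMap R A x.1 := fun l => by
    rw [← IsLocalization.mem_map_algebraMap_iff P.primeCompl,
      Localization.AtPrime.map_eq_maximalIdeal]
    exact (Submodule.span_generators m).le (Submodule.subset_span (e l).2)
  choose x hx using hmem
  refine ⟨fun l => (x l).1, fun l => (x l).1.2, fun y hy => ?_⟩
  have : algebraMap R A y ∈ (Ideal.span (Set.range fun l => ((x l).1 : R))).map (algebraMap R A) := by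
    have hy' : algebraMap R A y ∈ m := by
      have hm : P.map (algebraMap R A) = m := Localization.AtPrime.map_eq_maximalIdeal
      exact hm ▸ Ideal.mem_map_of_mem _ hy
    have hle : m ≤ (Ideal.span (Set.range fun l => ((x l).1 : R))).map (algebraMap R A) := by
      conv_lhs => rw [← Submodule.span_generators m]
      refine Submodule.span_le.mpr fun z hz => ?_
      obtain ⟨l, hl⟩ := e.surjective ⟨z, hz⟩
      have hz' : z = e l := by rw [hl]
      rw [hz', SetLike.mem_coe,
        ← Ideal.mul_unit_mem_iff_mem _ (IsLocalization.map_units A (x l).2), hx l]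
      exact Ideal.mem_map_of_mem _ (Ideal.subset_span ⟨l, rfl⟩)
    exact hle hy'
  exact (IsLocalization.algebraMap_mem_map_algebraMap_iff P.primeCompl A _ _).mp this

/-- Radicals commute with localization, and `P` becomes the only prime over `J`. Hence powers of
`√J` can be tested as powers of `P` locally at `P`. -/
theorem Ideal.map_radical_atPrime_of_mem_minimalPrimes {R : Type*} [CommRing R] {J P : Ideal R}
    [P.IsPrime] (hP : P ∈ J.minimalPrimes) :
    J.radical.map (algebraMap R (Localization.AtPrime P)) =
      P.map (algebraMap R (Localization.AtPrime P)) := by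
  rw [IsLocalization.map_radical P.primeCompl,
    IsLocalization.AtPrime.radical_map_of_mem_minimalPrimes _ P J hP]

/-- If `J` is homogeneous and `S ⧸ J` has positive dimension, then the irrelevant ideal is not
minimal over `J`. -/
theorem MvPolynomial.exists_X_notMem_of_mem_minimalPrimes {k σ : Type*} [Field k]
    {J P : Ideal (MvPolynomial σ k)} (hJ : J.IsHomogeneous (homogeneousSubmodule σ k))
    (hdim : 0 < ringKrullDim (MvPolynomial σ k ⧸ J)) (hP : P ∈ J.minimalPrimes) :
    ∃ j, X j ∉ P := by
  by_contra! hX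
  have := hP.1.1
  have hC : ∀ p : MvPolynomial σ k, p - C (constantCoeff p) ∈ P := fun p => by
    induction p using MvPolynomial.induction_on with
    | C a => simp
    | add p q hp hq => simpa [add_sub_add_comm] using P.add_mem hp hq
    | mul_X p j _ => simpa using P.mul_mem_left p (hX j)
  have hunit : ∀ I : Ideal (MvPolynomial σ k), ∀ c : k, C c ∈ I → I ≠ ⊤ → c = 0 :=
    fun I c hc hI => by
      by_contra h0
      exact hI (I.eq_top_of_isUnit_mem hc ((isUnit_iff_ne_zero.mpr h0).map C))
  have hmax : P.IsMaximal := by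
    refine ⟨⟨Ideal.IsPrime.ne_top', fun I hI => ?_⟩⟩
    by_contra hne
    refine hI.not_ge fun p hp => ?_
    have hc : C (constantCoeff p) ∈ I := by
      simpa using I.sub_mem hp (hI.le (hC p))
    simpa [hunit I _ hc hne] using hC p
  -- The homogeneous core of `Q` is a proper homogeneous ideal, so its elements have no constant
  -- term and it lies in `P`. Minimality of `P` then forces `P ≤ Q`, and `P` is maximal.
  have huniq : ∀ Q : Ideal (MvPolynomial σ k), Q.IsPrime → J ≤ Q → Q = P := fun Q hQ hJQ => by
    let Q' := Q.homogeneousCore (homogeneousSubmodule σ k)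
    have hQ' : Q'.toIdeal.IsPrime := hQ.homogeneousCore
    have hJQ' : J ≤ Q'.toIdeal := by
      rw [← hJ.toIdeal_homogeneousCore_eq_self]
      exact Ideal.homogeneousCore_mono _ hJQ
    have hle : Q'.toIdeal ≤ P := fun p hp => by
      have hc : C (constantCoeff p) ∈ Q'.toIdeal := by
        simpa [homogeneousComponent_zero, constantCoeff_eq] using
          homogeneousComponent_mem_of_mem Q'.isHomogeneous hp 0
      simpa [hunit _ _ hc hQ'.ne_top] using hC p
    exact (hmax.eq_of_le hQ.ne_top
      ((hP.2 ⟨hQ', hJQ'⟩ hle).trans (Ideal.toIdeal_homogeneousCore_le _ _))).symm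
  refine hdim.not_ge ?_
  have : Ring.KrullDimLE 0 (MvPolynomial σ k ⧸ J) := by
    refine Ring.krullDimLE_zero_iff.mpr fun I hI => ?_
    have hsurj : Function.Surjective (Ideal.Quotient.mk J) := Ideal.Quotient.mk_surjective
    have h := huniq (I.comap (Ideal.Quotient.mk J)) inferInstance
      (J.mk_ker.ge.trans (Ideal.comap_mono bot_le))
    have : (I.comap (Ideal.Quotient.mk J)).IsMaximal := h ▸ hmax
    rw [← Ideal.map_comap_of_surjective _ hsurj I]
    exact Ideal.IsMaximal.map_of_surjective_of_ker_le hsurj (Ideal.comap_mono bot_le)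
  simpa using Ring.krullDimLE_iff.mp this

/-- The Jacobian determinant of `d` forms of the same degree in a prime `P` not containing all the
variables lies, locally at `P`, in the `(d - P.height + 1)`-st power of `P`. -/
theorem MvPolynomial.exists_mul_det_jacobian_mem_pow {k : Type*} [Field k] {d : ℕ}
    (f : Fin d → MvPolynomial (Fin d) k) (δ : ℕ) (hf : ∀ i, (f i).IsHomogeneous δ)
    (P : Ideal (MvPolynomial (Fin d) k)) [P.IsPrime] (hfP : ∀ i, f i ∈ P) (j : Fin d)
    (hj : X j ∉ P) :
    ∃ t ∉ P, t * (Matrix.of fun i l : Fin d => pderiv l (f i)).det ∈ P ^ (d - P.height.toNat + 1) := by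
  obtain ⟨g, hg, hspan⟩ := P.exists_generators_atPrime_of_isRegularRing
  choose s' hs' hs'f using fun i => hspan (f i) (hfP i)
  let s := ∏ i, s' i
  have hs : s ∉ P := by
    simpa [s, Ideal.IsPrime.prod_mem_iff] using hs'
  have hsf : ∀ i, ∃ a : Fin P.height.toNat → MvPolynomial (Fin d) k,
      ∑ l, a l * g l = s * f i := fun i => by
    have h : s * f i ∈ Ideal.span (Set.range g) := by
      obtain ⟨c, hc⟩ := Finset.dvd_prod_of_mem s' (Finset.mem_univ i)
      rw [show s = s' i * c from hc, mul_right_comm, mul_comm]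
      exact Ideal.mul_mem_left _ _ (hs'f i)
    simpa [Ideal.mem_span_range_iff_exists_fun] using h
  choose a ha using hsf
  let A : Matrix (Fin d) (Fin P.height.toNat) (MvPolynomial (Fin d) k) := Matrix.of a
  let M : Matrix (Fin d) (Fin d) (MvPolynomial (Fin d) k) := Matrix.of fun i l => pderiv l (f i)
  -- Column `j` carries the Euler relation `∑ x_l ∂_l f_i = δ f_i`, while the other columns carry
  -- the product rule, with its remaining terms collected in `N`.
  let B : Matrix (Fin P.height.toNat) (Fin d) (MvPolynomial (Fin d) k) :=
    (Matrix.of fun l b => pderiv b (g l)).updateCol j fun l => (δ : MvPolynomial (Fin d) k) * g l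
  let N : Matrix (Fin d) (Fin d) (MvPolynomial (Fin d) k) :=
    (Matrix.of fun i b => ∑ l, pderiv b (a i l) * g l - pderiv b s * f i).updateCol j 0
  have hAB : (s • M).updateCol j (fun i => ∑ l, (X l : MvPolynomial (Fin d) k) • (s • M) i l) = A * B + N := by
    ext1 i b
    have hsum : (A * B) i b = ∑ l, a i l * B l b := rfl
    rw [Matrix.add_apply, hsum]
    by_cases hb : b = j
    · subst hb
      simp only [Matrix.updateCol_self, B, N, Pi.zero_apply, add_zero, Matrix.smul_apply,
        smul_eq_mul, M, Matrix.of_apply]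
      simp_rw [mul_left_comm _ s, mul_left_comm _ (δ : MvPolynomial (Fin d) k)]
      rw [← Finset.mul_sum, ← Finset.mul_sum, (hf i).sum_X_mul_pderiv, ha, nsmul_eq_mul,
        mul_left_comm]
    · simp only [Matrix.updateCol_ne hb, B, N, Matrix.smul_apply, smul_eq_mul, M, Matrix.of_apply]
      have h := congrArg (pderiv b) (ha i)
      simp only [map_sum, Derivation.leibniz, smul_eq_mul, Finset.sum_add_distrib] at h
      simp_rw [mul_comm (pderiv b (a i _))]
      linear_combination -h
  have hdet : s ^ d * X j * M.det = (A * B + N).det := by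
    rw [← hAB, Matrix.det_updateCol_sum, Matrix.det_smul, Fintype.card_fin, smul_eq_mul]
    ring
  refine ⟨s ^ d * X j, ?_, ?_⟩
  · intro hmem
    rcases Ideal.IsPrime.mem_or_mem ‹_› hmem with h | h
    · exact hs (Ideal.IsPrime.mem_of_pow_mem ‹_› _ h)
    · exact hj h
  · have h := Matrix.det_add_mem_pow_of_col_mem P A B N j (fun l => ?_) (fun i b => ?_)
      (fun i => by simp [N])
    · simpa [hdet, M] using h
    · simpa [B] using P.mul_mem_left _ (hg l)
    · by_cases hb : b = j
      · subst hb; simp [N]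
      · simp only [N, Matrix.updateCol_ne hb, Matrix.of_apply]
        exact P.sub_mem (P.sum_mem fun l _ => P.mul_mem_left _ (hg l)) (P.mul_mem_left _ (hfP i))

theorem proposition6p3 {k : Type*} [Field k] [PerfectField k] {d : ℕ}
    {ι : Type*} (f : ι → MvPolynomial (Fin d) k) (δ : ℕ)
    (hf : ∀ i, (f i).IsHomogeneous δ)
    (J : Ideal (MvPolynomial (Fin d) k)) (hJ : J = Ideal.span (Set.range f))
    (hdim : 0 < ringKrullDim (MvPolynomial (Fin d) k ⧸ J))
    (r : Fin d → ι) :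
    ((jacobianMatrix f).submatrix r id).det ∈
      symbolicPower J.radical (d - (bigHeight J).toNat + 1) := by
  subst hJ
  have hhom : (Ideal.span (Set.range f)).IsHomogeneous (homogeneousSubmodule (Fin d) k) :=
    Ideal.homogeneous_span _ _ (by rintro _ ⟨i, rfl⟩; exact ⟨δ, hf i⟩)
  rw [symbolicPower, Submodule.mem_iInf]
  intro p
  rw [Submodule.mem_iInf]
  intro hp
  rw [Ideal.radical_minimalPrimes] at hp
  let P := p.asIdeal
  have hP : P.IsPrime := p.2
  obtain ⟨j, hj⟩ := exists_X_notMem_of_mem_minimalPrimes hhom hdim hp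
  obtain ⟨t, ht, hmem⟩ := exists_mul_det_jacobian_mem_pow (fun i => f (r i)) δ (fun i => hf (r i)) P
    (fun i => hp.1.2 (Ideal.subset_span ⟨r i, rfl⟩)) j hj
  -- Finiteness matters because `toNat` sends `⊤` to `0`; all heights are at most `d`.
  have hbig : bigHeight (Ideal.span (Set.range f)) ≠ ⊤ := by
    refine ne_top_of_le_ne_top (ENat.natCast_ne_top d) (iSup₂_le fun q hq => ?_)
    have : q.IsPrime := hq.1.1
    have h := Ideal.height_le_ringKrullDim_of_isPrime (I := q)
    rw [MvPolynomial.ringKrullDim_of_isNoetherianRing, ringKrullDim_eq_zero_of_field, zero_add,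
      Nat.card_fin] at h
    exact WithBot.coe_le_coe.mp h
  have hle : P.height.toNat ≤ (bigHeight (Ideal.span (Set.range f))).toNat :=
    ENat.toNat_le_toNat (le_iSup₂_of_le P hp le_rfl) hbig
  rw [Ideal.mem_comap, Ideal.map_pow, Ideal.map_radical_atPrime_of_mem_minimalPrimes hp,
    ← Ideal.map_pow]
  refine (IsLocalization.algebraMap_mem_map_algebraMap_iff P.primeCompl _ _ _).mpr ⟨t, ht, ?_⟩
  -- The height of `P` is at most the big height, so the local exponent is at least the required
  -- one.
  exact Ideal.pow_le_pow_right (by omega) hmem
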